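/- Let $N\ge 1$, $\mathbb T=\mathbb R/\mathbb Z$, and identify all tangent spaces of $\mathbb T^{2N}$ (points $z=(x,y)$, $x,y\in\mathbb T^N$) with $\mathbb R^{2N}=\mathbb R^N\oplus\mathbb R^N$ with its Euclidean norm. For $\alpha>0$ put $\mathcal C^x_\alpha=\{(u,v)\in\mathbb R^N\oplus\mathbb R^N:\|v\|\le\alpha\|u\|\}$. Let $\operatorname{Leb}_{\operatorname{Gr}_N(\mathbb R^{2N})}$ be the Riemannian volume of the Grassmannian of $N$-planes in $\mathbb R^{2N}$, normalized to total mass one (i.e. the Borel probability measure invariant under the orthogonal group $O(2N)$). For every $N\ge1$, $C_0>0$ and $\beta\in(0,1)$ there is $L_0=L_0(N,C_0,\beta)\ge 1$ with the following property. Let $f_L:\mathbb T^N\to\mathbb T^N$ ($L\ge1$) be a family of $C^1$ maps with $\|D_xf_L\|\le C_0L$ for all $x\in\mathbb T^N$, $L\geq 1$ (for instance reductions modulo $1$ of maps $\mathbb T^N\to\mathbb R^N$), and let $$F_L:\mathbb T^{2N}\to\mathbb T^{2N},\qquad F_L(x,y)=(f_L(x)-y,\,x).$$ Let $(\Omega_0,\mathcal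 F_0,\mathbb P_0)$ be a probability space and let $\omega\mapsto R_\omega$ be a measurable assignment of a volume-preserving $C^2$ diffeomorphism $R_\omega$ of $\mathbb T^{2N}$ to each $\omega\in\Omega_0$, such that for $\mathbb P_0$-almost every $\omega$ and all $z\in\mathbb T^{2N}$, $$D_zR_\omega(\mathcal C^x_{1/20})\subset\mathcal C^x_{1/10},\qquad \|D_zR_\omega\|\le 2,\qquad \|(D_zR_\omega)^{-1}\|\le2 .$$ For $\underline\omega=(\omega_1,\omega_2,\dots)\in\Omega_0^{\mathbb N}$ write $F^n_{\underline\omega}=F_{\omega_n}\circ\dots\circ F_{\omega_1}$ with $F_\omega=R_\omega\circ F_L$, and let $G^n_\beta$ be the set of $z\in\mathbb T^{2N}$ such that for each $0\le i\le n-1$ the $x$-component $x_i\in\mathbb T^N$ of $F^i_{\underline\omega}(z)$ satisfies $|\det D_{x_i}f_L|>L^{N-(1-\beta)}$. Then for every $L\ge L_0$ and for $\mathbb P_0^{\otimes\mathbb N}$-almost every $\underline\omega$, we have for all $n\ge1$ and all $z\in G^n_\beta$ that $$\operatorname{Leb}_{\operatorname{Gr}_N(\mathbb R^{2N})}\bigl\{E\in\operatorname{Gr}_N(\mathbb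 R^{2N}) : D_zF^n_{\underline\omega}(E)\not\subset\mathcal C^x_2\bigr\}\le L^{-\beta n}.$$ -/

import Mathlib

open MeasureTheory Topology

noncomputable section

/-! ### Differential calculus on tori `ℝ^ι / ℤ^ι` -/

/-- The torus `𝕋^ι = ℝ^ι / ℤ^ι`. -/
abbrev Torus (ι : Type*) : Type _ := ι → UnitAddCircle

/-- The covering map `ℝ^ι → 𝕋^ι`; `ℝ^ι` carries the Euclidean norm and serves as the tangent
space of the torus at each of its points. -/
def torusProj {ι : Type*} (u : EuclideanSpace ℝ ι) : Torus ι := fun i => (u i : UnitAddCircle)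

/-- `G` is a lift of the torus map `g` to the universal cover. -/
def IsTorusLift {ι : Type*} (G : EuclideanSpace ℝ ι → EuclideanSpace ℝ ι)
    (g : Torus ι → Torus ι) : Prop :=
  ∀ u, torusProj (G u) = g (torusProj u)

/-- `g : 𝕋^ι → 𝕋^ι` is of class `C^k`, i.e. it has a `C^k` lift to the universal cover. -/
def TorusContDiff {ι : Type*} [Fintype ι] (k : WithTop ℕ∞) (g : Torus ι → Torus ι) : Prop :=
  ∃ G : EuclideanSpace ℝ ι → EuclideanSpace ℝ ι, ContDiff ℝ k G ∧ IsTorusLift G g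

/-- `g` has derivative `A` at `z`, where the tangent spaces at `z` and at `g z` are both
identified with `ℝ^ι` through the covering map. (The lift is only required to be differentiable at
one point above `z`; nothing is asked of it elsewhere, so this is a local condition.) -/
def HasTorusDerivAt {ι : Type*} [Fintype ι] (g : Torus ι → Torus ι)
    (A : EuclideanSpace ℝ ι →L[ℝ] EuclideanSpace ℝ ι) (z : Torus ι) : Prop :=
  ∃ (G : EuclideanSpace ℝ ι → EuclideanSpace ℝ ι) (u : EuclideanSpace ℝ ι),
    IsTorusLift G g ∧ torusProj u = z ∧ HasFDerivAt G A u

open scoped Classical in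
/-- The derivative `D_z g` of a torus map (and `0` if `g` is not differentiable at `z`). -/
def torusDeriv {ι : Type*} [Fintype ι] (g : Torus ι → Torus ι) (z : Torus ι) :
    EuclideanSpace ℝ ι →L[ℝ] EuclideanSpace ℝ ι :=
  if h : ∃ A, HasTorusDerivAt g A z then h.choose else 0

/-- Derivatives of torus maps are unique. -/
theorem HasTorusDerivAt.unique {ι : Type*} [Fintype ι] {g : Torus ι → Torus ι}
    {A B : EuclideanSpace ℝ ι →L[ℝ] EuclideanSpace ℝ ι} {z : Torus ι}
    (hA : HasTorusDerivAt g A z) (hB : HasTorusDerivAt g B z) : A = B := by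
  obtain ⟨G, u, hG, hu, hGA⟩ := hA
  obtain ⟨H, w, hH, hw, hHB⟩ := hB
  have hshift : ∀ v, torusProj (v + (w - u)) = torusProj v := by
    intro v
    funext i
    have h := congrFun (hw.trans hu.symm) i
    simp only [torusProj] at h ⊢
    simp [h]
  have hHB' : HasFDerivAt (fun v => H (v + (w - u))) B u := by
    rw [hasFDerivAt_comp_add_right]
    simpa using hHB
  have hD := hGA.sub hHB'
  set D := G - fun v => H (v + (w - u)) with hDdef
  have hint : ∀ v i, ∃ m : ℤ, (m : ℝ) = D v i := by
    intro v i
    have h : torusProj (G v) i = torusProj (H (v + (w - u))) i := by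
      rw [hG v, hH, hshift]
    simp only [torusProj] at h
    have h0 : ((D v i : ℝ) : UnitAddCircle) = 0 := by
      simp [hDdef, h]
    obtain ⟨m, hm⟩ := (AddCircle.coe_eq_zero_iff (1 : ℝ)).1 h0
    exact ⟨m, by simpa using hm⟩
  have hev : D =ᶠ[𝓝 u] fun _ => D u := by
    filter_upwards [Metric.tendsto_nhds.1 hD.continuousAt.tendsto 1 one_pos] with v hv
    ext i
    obtain ⟨m, hm⟩ := hint v i
    obtain ⟨k, hk⟩ := hint u i
    have h1 : |D v i - D u i| < 1 := by
      have h2 := (PiLp.norm_apply_le (D v - D u) i).trans_lt (by rwa [← dist_eq_norm])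
      simpa using h2
    rw [← hm, ← hk] at h1 ⊢
    have h4 : m = k := by
      rw [abs_lt] at h1
      have h2 : (m : ℝ) < (k + 1 : ℤ) := by push_cast; linarith [h1.2]
      have h3 : ((k - 1 : ℤ) : ℝ) < m := by push_cast; linarith [h1.1]
      have h2' := Int.cast_lt.1 h2
      have h3' := Int.cast_lt.1 h3
      lia
    rw [h4]
  have h0 := (hasFDerivAt_const (𝕜 := ℝ) (D u) u).congr_of_eventuallyEq hev
  exact sub_eq_zero.1 (hD.unique h0)

theorem HasTorusDerivAt.torusDeriv_eq {ι : Type*} [Fintype ι] {g : Torus ι → Torus ι}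
    {A : EuclideanSpace ℝ ι →L[ℝ] EuclideanSpace ℝ ι} {z : Torus ι}
    (hA : HasTorusDerivAt g A z) : torusDeriv g z = A := by
  have h : ∃ A, HasTorusDerivAt g A z := ⟨A, hA⟩
  rw [torusDeriv, dif_pos h]
  exact h.choose_spec.unique hA

/-! ### The Grassmannian of a Euclidean space and its normalized Riemannian volume -/

section Grassmannian

variable (V : Type*) [NormedAddCommGroup V] [InnerProductSpace ℝ V] [FiniteDimensional ℝ V]

/-- The Grassmannian `Gr_k(V)` of `k`-dimensional linear subspaces of `V`. -/
def Grassmann (k : ℕ) : Type _ := {E : Submodule ℝ V // Module.finrank ℝ E = k}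

/-- The orthogonal group of `V`. -/
abbrev OrthGroup : Type _ := unitary (V →L[ℝ] V)

variable {V}

/-- The usual topology of the Grassmannian: the one of the distance `‖Π_E - Π_{E'}‖` between
orthogonal projections. -/
instance Grassmann.instTopologicalSpace (k : ℕ) : TopologicalSpace (Grassmann V k) :=
  TopologicalSpace.induced (fun E => E.1.starProjection) inferInstance

instance Grassmann.instMeasurableSpace (k : ℕ) : MeasurableSpace (Grassmann V k) :=
  borel (Grassmann V k)

instance Grassmann.instBorelSpace (k : ℕ) : BorelSpace (Grassmann V k) := ⟨rfl⟩

instance OrthGroup.instCompactSpace : CompactSpace (OrthGroup V) := by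
  have : ProperSpace (V →L[ℝ] V) := FiniteDimensional.proper ℝ _
  have hc : IsCompact (unitary (V →L[ℝ] V) : Set (V →L[ℝ] V)) := by
    refine Metric.isCompact_of_isClosed_isBounded isClosed_unitary ?_
    refine (Metric.isBounded_closedBall (x := (0 : V →L[ℝ] V)) (r := 1)).subset ?_
    intro U hU
    rw [mem_closedBall_zero_iff]
    refine ContinuousLinearMap.opNorm_le_bound _ zero_le_one fun x => ?_
    have h := (Unitary.linearIsometryEquiv (𝕜 := ℝ) (H := V) ⟨U, hU⟩).norm_map x
    have h2 : (Unitary.linearIsometryEquiv (𝕜 := ℝ) (H := V) ⟨U, hU⟩) x = U x := rfl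
    rw [h2] at h
    simp [h]
  exact isCompact_iff_compactSpace.mp hc

/-- The action `E ↦ U(E)` of the orthogonal group on the Grassmannian. -/
def Grassmann.rotate {k : ℕ} (U : OrthGroup V) (E : Grassmann V k) : Grassmann V k :=
  ⟨E.1.map ((Unitary.linearIsometryEquiv (𝕜 := ℝ) (H := V) U).toLinearEquiv : V →ₗ[ℝ] V),
    (LinearEquiv.finrank_map_eq _ _).trans E.2⟩

theorem Grassmann.mem_rotate {k : ℕ} (U : OrthGroup V) (E : Grassmann V k) (v : V) :
    v ∈ (Grassmann.rotate U E).1 ↔ ∃ w ∈ E.1, (U : V →L[ℝ] V) w = v := Iff.rfl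

/-- The normalized Riemannian volume of `Gr_k(V)`: the image of the Haar probability measure of
the orthogonal group under `U ↦ U(E₀)`. It is the unique Borel probability measure on `Gr_k(V)`
that is invariant under the orthogonal group, and does not depend on the base point `E₀`. -/
def Grassmann.leb {k : ℕ} (E₀ : Grassmann V k) : Measure (Grassmann V k) :=
  (Measure.haarMeasure (⊤ : TopologicalSpace.PositiveCompacts (OrthGroup V))).map
    (fun U => Grassmann.rotate U E₀)

theorem Grassmann.continuous_rotate {k : ℕ} (E₀ : Grassmann V k) :
    Continuous (fun U : OrthGroup V => Grassmann.rotate U E₀) := by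
  refine continuous_induced_rng.mpr ?_
  have : ((fun E : Grassmann V k => E.1.starProjection) ∘ fun U : OrthGroup V =>
      Grassmann.rotate U E₀) = fun U : OrthGroup V =>
        (U : V →L[ℝ] V) * E₀.1.starProjection * ((star U : OrthGroup V) : V →L[ℝ] V) := by
    funext U
    ext v
    exact Submodule.starProjection_map_apply (Unitary.linearIsometryEquiv (𝕜 := ℝ) (H := V) U) E₀.1 v
  rw [this]
  fun_prop

instance Grassmann.isProbabilityMeasure_leb {k : ℕ} (E₀ : Grassmann V k) :
    IsProbabilityMeasure (Grassmann.leb E₀) := by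
  have : IsProbabilityMeasure
      (Measure.haarMeasure (⊤ : TopologicalSpace.PositiveCompacts (OrthGroup V))) :=
    ⟨Measure.haarMeasure_self⟩
  exact Measure.isProbabilityMeasure_map
    (Grassmann.continuous_rotate E₀).measurable.aemeasurable

theorem Grassmann.rotate_mul {k : ℕ} (U W : OrthGroup V) (E : Grassmann V k) :
    Grassmann.rotate (U * W) E = Grassmann.rotate U (Grassmann.rotate W E) := by
  refine Subtype.ext (Submodule.ext fun v => ?_)
  simp only [Grassmann.mem_rotate]
  constructor
  · rintro ⟨w, hw, rfl⟩
    exact ⟨_, ⟨w, hw, rfl⟩, rfl⟩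
  · rintro ⟨_, ⟨w, hw, rfl⟩, rfl⟩
    exact ⟨w, hw, rfl⟩

/-- The volume is invariant under the orthogonal group. -/
theorem Grassmann.leb_preimage_rotate {k : ℕ} (E₀ : Grassmann V k) (U : OrthGroup V)
    (S : Set (Grassmann V k)) (hS : MeasurableSet S) :
    Grassmann.leb E₀ (Grassmann.rotate U ⁻¹' S) = Grassmann.leb E₀ S := by
  have hc := (Grassmann.continuous_rotate E₀).measurable
  have hU : Measurable (Grassmann.rotate (k := k) U) := by
    have : Continuous (Grassmann.rotate (k := k) U) := by
      refine continuous_induced_rng.mpr ?_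
      have h : ((fun E : Grassmann V k => E.1.starProjection) ∘ Grassmann.rotate U) =
          fun E : Grassmann V k =>
            (U : V →L[ℝ] V) * E.1.starProjection * ((star U : OrthGroup V) : V →L[ℝ] V) := by
        funext E
        ext v
        exact Submodule.starProjection_map_apply
          (Unitary.linearIsometryEquiv (𝕜 := ℝ) (H := V) U) E.1 v
      rw [h]
      have : Continuous (fun E : Grassmann V k => E.1.starProjection) := continuous_induced_dom
      fun_prop
    exact this.measurable
  rw [Grassmann.leb, Measure.map_apply hc hS, Measure.map_apply hc (hU hS)]
  have : (fun W : OrthGroup V => Grassmann.rotate W E₀) ⁻¹' (Grassmann.rotate U ⁻¹' S) =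
      (fun W => U * W) ⁻¹' ((fun W : OrthGroup V => Grassmann.rotate W E₀) ⁻¹' S) := by
    ext W
    simp [Grassmann.rotate_mul]
  rw [this, measure_preimage_mul]

end Grassmannian

/-! ### The tangent space `ℝ^{2N} = ℝ^x ⊕ ℝ^y` of the phase space -/

/-- `ℝ^{2N}`, with the `x`-coordinates in the left and the `y`-coordinates in the right block. -/
abbrev PhaseVec (N : ℕ) : Type := EuclideanSpace ℝ (Fin N ⊕ Fin N)

/-- The component `u` of `w = (u, v)`. -/
def PhaseVec.xPart {N : ℕ} (w : PhaseVec N) : EuclideanSpace ℝ (Fin N) :=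
  WithLp.toLp 2 fun i => w (Sum.inl i)

/-- The component `v` of `w = (u, v)`. -/
def PhaseVec.yPart {N : ℕ} (w : PhaseVec N) : EuclideanSpace ℝ (Fin N) :=
  WithLp.toLp 2 fun i => w (Sum.inr i)

/-- The horizontal cone `𝓒^x_α = {(u, v) : ‖v‖ ≤ α ‖u‖}`. -/
def coneX (N : ℕ) (α : ℝ) : Set (PhaseVec N) := {w | ‖PhaseVec.yPart w‖ ≤ α * ‖PhaseVec.xPart w‖}

/-- The horizontal plane `ℝ^x`, spanned by the first `N` coordinate vectors. -/
def horizontalPlane (N : ℕ) : Grassmann (PhaseVec N) N :=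
  ⟨Submodule.span ℝ (Set.range fun i : Fin N => EuclideanSpace.single (Sum.inl i) (1 : ℝ)), by
    rw [finrank_span_eq_card, Fintype.card_fin]
    have h := (EuclideanSpace.basisFun (Fin N ⊕ Fin N) ℝ).orthonormal.linearIndependent.comp
      Sum.inl Sum.inl_injective
    have he : ⇑(EuclideanSpace.basisFun (Fin N ⊕ Fin N) ℝ) ∘ Sum.inl =
        fun i : Fin N => EuclideanSpace.single (Sum.inl i) (1 : ℝ) := by
      funext i
      simp
    rwa [he] at h⟩

/-- `Leb_{Gr_N(ℝ^{2N})}`, normalized to have total mass one. -/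
def grassmannLeb (N : ℕ) : Measure (Grassmann (PhaseVec N) N) :=
  Grassmann.leb (horizontalPlane N)

/-! ### The random dynamical system -/

/-- The phase space `𝕋^{2N} = 𝕋^N × 𝕋^N`, with points `z = (x, y)`. -/
abbrev PhaseTorus (N : ℕ) : Type := Torus (Fin N ⊕ Fin N)

/-- The component `x` of `z = (x, y)`. -/
def PhaseTorus.x {N : ℕ} (z : PhaseTorus N) : Torus (Fin N) := fun i => z (Sum.inl i)

/-- The component `y` of `z = (x, y)`. -/
def PhaseTorus.y {N : ℕ} (z : PhaseTorus N) : Torus (Fin N) := fun i => z (Sum.inr i)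

/-- The map `F(x, y) = (f(x) - y, x)`. -/
def baseMap {N : ℕ} (f : Torus (Fin N) → Torus (Fin N)) (z : PhaseTorus N) : PhaseTorus N :=
  Sum.elim (f z.x - z.y) z.x

/-- `F^n_ω = F_{ω_n} ∘ ⋯ ∘ F_{ω_1}` with `F_ω = R_ω ∘ F`; the entries of `ω` are indexed from `0`,
so that `ω_i` is `ω (i - 1)`. -/
def randomIterate {N : ℕ} {Ω₀ : Type*} (f : Torus (Fin N) → Torus (Fin N))
    (R : Ω₀ → PhaseTorus N ≃ PhaseTorus N) (ω : ℕ → Ω₀) : ℕ → PhaseTorus N → PhaseTorus N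
  | 0, z => z
  | n + 1, z => R (ω n) (baseMap f (randomIterate f R ω n z))

/-- `R` is a volume-preserving `C²` diffeomorphism of the phase space. -/
structure IsC2VolDiffeo {N : ℕ} (R : PhaseTorus N ≃ PhaseTorus N) : Prop where
  contDiff : TorusContDiff 2 R
  contDiff_symm : TorusContDiff 2 R.symm
  measurePreserving : MeasurePreserving R volume volume

/-- The cone condition on one noise map `R`: for every `z`, `D_z R` maps `𝓒^x_{1/20}` into
`𝓒^x_{1/10}`, and `‖D_z R‖, ‖(D_z R)⁻¹‖ ≤ 2`. -/
structure ConeCondition {N : ℕ} (R : PhaseTorus N ≃ PhaseTorus N) : Prop where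
  mapsTo : ∀ z, Set.MapsTo (torusDeriv R z) (coneX N (1 / 20)) (coneX N (1 / 10))
  norm_le : ∀ z, ‖torusDeriv R z‖ ≤ 2
  norm_inverse_le : ∀ z, ‖(torusDeriv R z).inverse‖ ≤ 2

/-- The good set `G_β = {x ∈ 𝕋^N : |det D_x f| > L^{N - (1 - β)}}`. -/
def goodSet {N : ℕ} (f : Torus (Fin N) → Torus (Fin N)) (L β : ℝ) : Set (Torus (Fin N)) :=
  {x | L ^ ((N : ℝ) - (1 - β)) < |(torusDeriv f x).det|}

/-- `G^n_β`: the points `z` such that the `x`-components of `Z_0 = z, Z_1, …, Z_{n-1}`, where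
`Z_i = F^i_ω(z)`, all lie in `G_β`. -/
def goodOrbitSet {N : ℕ} {Ω₀ : Type*} (f : Torus (Fin N) → Torus (Fin N)) (L β : ℝ)
    (R : Ω₀ → PhaseTorus N ≃ PhaseTorus N) (ω : ℕ → Ω₀) (n : ℕ) : Set (PhaseTorus N) :=
  {z | ∀ i < n, (randomIterate f R ω i z).x ∈ goodSet f L β}

end

/-! On the good set the determinant of `D f` exceeds `L^(N-1+β)` while its norm is at most `C₀ L`.
By Hadamard's inequality its least stretch is then at least `Λ = c L^β` with `c = C₀^(-(N-1))`.

For `Λ ≥ 40` the cone `𝓒^x_2` is forward invariant, and each step multiplies the `x`-part of its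
vectors by at least `Λ/4` (`iterate_shear_expands`). By invariance, a vector ending outside the cone
was outside it at every earlier time, and each step multiplied its norm by at most `84/Λ`
(`iterate_shear_contracts`). Let `T` be the `x`-part of `D F^n`. Then `T` stretches horizontal
vectors by at least `s = (Λ/4)^n`, while a bad plane contains a unit vector `v` with `‖T v‖ ≤ ε =
(84/Λ)^n`.

It remains to see that such planes have volume at most a constant times `ε/s`
(`grassmannLeb_exists_norm_le`). Write the plane as `U` applied to the horizontal plane, with `U`
Haar distributed. Pick a coordinate `j` in which the preimage of `v` is not small, and a unit vector
`a` normal to `T U e_i` for all `i ≠ j`. Then `⟨a, T U e_j⟩` is of order `ε`, although the adjoint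
of `T` maps `a` to a vector of norm at least `s`. Averaging `U` over a circle of reflections in the
plane of `e_j` and one vertical basis vector turns this into a sublevel estimate for `A cos θ + B
sin θ`.

The result is `K (336/Λ²)^n`. Of the two factors `L^(-β)` in `Λ^(-2)`, one absorbs all constants and
the other is the claimed bound. -/

noncomputable section

/-! ### Least stretch of a linear map with large determinant -/

/-- Hadamard's inequality in the form of a lower bound for the stretch of a linear map. -/
theorem ContinuousLinearMap.abs_det_mul_norm_le {E : Type*} [NormedAddCommGroup E]
    [InnerProductSpace ℝ E] {m : ℕ} (hE : Module.finrank ℝ E = m + 1) (M : E →L[ℝ] E) {K : ℝ}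
    (hK : ‖M‖ ≤ K) (u : E) : |M.det| * ‖u‖ ≤ K ^ m * ‖M u‖ := by
  have : FiniteDimensional ℝ E := Module.finite_of_finrank_eq_succ hE
  have : Fact (Module.finrank ℝ E = m + 1) := ⟨hE⟩
  rcases eq_or_ne u 0 with rfl | hu
  · simp
  have hu' : 0 < ‖u‖ := norm_pos_iff.2 hu
  have he : ‖(‖u‖⁻¹ • u)‖ = 1 := by
    rw [norm_smul, norm_inv, norm_norm, inv_mul_cancel₀ hu'.ne']
  -- An orthonormal basis whose vector of index 0 is `u / ‖u‖`. The constant family is orthonormal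
  -- on `{0}`, the only index prescribed.
  obtain ⟨b, hb⟩ := Orthonormal.exists_orthonormalBasis_extension_of_card_eq (𝕜 := ℝ) (E := E)
    (ι := Fin (m + 1)) (by simpa using hE) (v := fun _ => ‖u‖⁻¹ • u) (s := {0}) (by
      refine ⟨fun i => he, fun i j hij => (hij ?_).elim⟩
      exact Subtype.ext (i.2.trans j.2.symm))
  have hb0 : b 0 = ‖u‖⁻¹ • u := hb 0 rfl
  have h1 : |M.det| ≤ ∏ i, ‖M (b i)‖ := by
    have h2 := b.toBasis.orientation.abs_volumeForm_apply_le (⇑(M : E →ₗ[ℝ] E) ∘ b)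
    rw [Orientation.volumeForm_robust _ b rfl, Module.Basis.det_comp, ← b.coe_toBasis,
      Module.Basis.det_self, mul_one] at h2
    simpa using h2
  have hK0 : 0 ≤ K := (norm_nonneg M).trans hK
  -- The factor of index 0 carries `‖M u‖`; each of the other `m` is at most `K`.
  have h3 : ∏ i, ‖M (b i)‖ ≤ (‖u‖⁻¹ * ‖M u‖) * K ^ m := by
    rw [Fin.prod_univ_succ, hb0, map_smul, norm_smul, norm_inv, norm_norm]
    gcongr
    calc ∏ i : Fin m, ‖M (b i.succ)‖ ≤ ∏ _i : Fin m, K := by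
          refine Finset.prod_le_prod (fun _ _ => norm_nonneg _) fun i _ => ?_
          simpa using (M.le_of_opNorm_le hK (b i.succ))
      _ = K ^ m := by simp
  calc |M.det| * ‖u‖ ≤ ((‖u‖⁻¹ * ‖M u‖) * K ^ m) * ‖u‖ := by gcongr; exact h1.trans h3
    _ = K ^ m * ‖M u‖ := by field_simp

/-! ### Linear structure of the phase space -/

namespace PhaseVec

variable {N : ℕ}

/-- `PhaseVec.xPart` as a continuous linear map. -/
def xL (N : ℕ) : PhaseVec N →L[ℝ] EuclideanSpace ℝ (Fin N) :=
  LinearMap.toContinuousLinearMap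
    { toFun := PhaseVec.xPart
      map_add' := fun _ _ => rfl
      map_smul' := fun _ _ => rfl }

/-- `PhaseVec.yPart` as a continuous linear map. -/
def yL (N : ℕ) : PhaseVec N →L[ℝ] EuclideanSpace ℝ (Fin N) :=
  LinearMap.toContinuousLinearMap
    { toFun := PhaseVec.yPart
      map_add' := fun _ _ => rfl
      map_smul' := fun _ _ => rfl }

/-- The inclusion `u ↦ (u, 0)`. -/
def inlL (N : ℕ) : EuclideanSpace ℝ (Fin N) →L[ℝ] PhaseVec N :=
  LinearMap.toContinuousLinearMap
    { toFun := fun u => WithLp.toLp 2 (Sum.elim u 0)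
      map_add' := fun u v => by ext (i | i) <;> simp
      map_smul' := fun c u => by ext (i | i) <;> simp }

/-- The inclusion `v ↦ (0, v)`. -/
def inrL (N : ℕ) : EuclideanSpace ℝ (Fin N) →L[ℝ] PhaseVec N :=
  LinearMap.toContinuousLinearMap
    { toFun := fun u => WithLp.toLp 2 (Sum.elim 0 u)
      map_add' := fun u v => by ext (i | i) <;> simp
      map_smul' := fun c u => by ext (i | i) <;> simp }

theorem xL_apply (w : PhaseVec N) : xL N w = xPart w := rfl

theorem yL_apply (w : PhaseVec N) : yL N w = yPart w := rfl

@[simp]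
theorem xPart_apply (w : PhaseVec N) (i : Fin N) : xPart w i = w (Sum.inl i) := rfl

@[simp]
theorem yPart_apply (w : PhaseVec N) (i : Fin N) : yPart w i = w (Sum.inr i) := rfl

@[simp]
theorem inlL_apply_inl (u : EuclideanSpace ℝ (Fin N)) (i : Fin N) :
    inlL N u (Sum.inl i) = u i := rfl

@[simp]
theorem inlL_apply_inr (u : EuclideanSpace ℝ (Fin N)) (i : Fin N) :
    inlL N u (Sum.inr i) = 0 := rfl

@[simp]
theorem inrL_apply_inl (u : EuclideanSpace ℝ (Fin N)) (i : Fin N) :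
    inrL N u (Sum.inl i) = 0 := rfl

@[simp]
theorem inrL_apply_inr (u : EuclideanSpace ℝ (Fin N)) (i : Fin N) :
    inrL N u (Sum.inr i) = u i := rfl

@[simp]
theorem xPart_inlL (u : EuclideanSpace ℝ (Fin N)) : xPart (inlL N u) = u := rfl

@[simp]
theorem yPart_inlL (u : EuclideanSpace ℝ (Fin N)) : yPart (inlL N u) = 0 := rfl

theorem norm_sq_eq (w : PhaseVec N) : ‖w‖ ^ 2 = ‖xPart w‖ ^ 2 + ‖yPart w‖ ^ 2 := by
  simp [EuclideanSpace.norm_sq_eq, Fintype.sum_sum_type]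

theorem norm_xPart_le (w : PhaseVec N) : ‖xPart w‖ ≤ ‖w‖ :=
  le_of_sq_le_sq (by nlinarith [norm_sq_eq w, sq_nonneg ‖yPart w‖]) (norm_nonneg _)

theorem norm_yPart_le (w : PhaseVec N) : ‖yPart w‖ ≤ ‖w‖ :=
  le_of_sq_le_sq (by nlinarith [norm_sq_eq w, sq_nonneg ‖xPart w‖]) (norm_nonneg _)

theorem norm_le_add (w : PhaseVec N) : ‖w‖ ≤ ‖xPart w‖ + ‖yPart w‖ :=
  le_of_sq_le_sq (by nlinarith [norm_sq_eq w, norm_nonneg (xPart w), norm_nonneg (yPart w)])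
    (by positivity)

/-- The linear map `(u, v) ↦ (M u - v, u)`. -/
def shear (M : EuclideanSpace ℝ (Fin N) →L[ℝ] EuclideanSpace ℝ (Fin N)) :
    PhaseVec N →L[ℝ] PhaseVec N :=
  inlL N ∘L (M ∘L xL N - yL N) + inrL N ∘L xL N

@[simp]
theorem xPart_shear (M : EuclideanSpace ℝ (Fin N) →L[ℝ] EuclideanSpace ℝ (Fin N))
    (w : PhaseVec N) : xPart (shear M w) = M (xPart w) - yPart w := by
  ext i
  simp [shear, xL_apply, yL_apply]

@[simp]
theorem yPart_shear (M : EuclideanSpace ℝ (Fin N) →L[ℝ] EuclideanSpace ℝ (Fin N))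
    (w : PhaseVec N) : yPart (shear M w) = xPart w := by
  ext i
  simp [shear, xL_apply, yL_apply]

end PhaseVec

open PhaseVec

/-! ### One step of the cocycle -/

section Step

variable {N : ℕ} {M : EuclideanSpace ℝ (Fin N) →L[ℝ] EuclideanSpace ℝ (Fin N)} {Λ : ℝ}
  {A : PhaseVec N →L[ℝ] PhaseVec N}

theorem norm_shear_ge (hM : ∀ u, Λ * ‖u‖ ≤ ‖M u‖) (w : PhaseVec N)
    (hw : w ∈ coneX N 2) : (Λ - 2) * ‖xPart w‖ ≤ ‖xPart (shear M w)‖ := by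
  have h1 : ‖yPart w‖ ≤ 2 * ‖xPart w‖ := hw
  have h2 := norm_sub_norm_le (M (xPart w)) (yPart w)
  rw [xPart_shear]
  linarith [hM (xPart w)]

theorem shear_mem_coneX (hΛ : 40 ≤ Λ) (hM : ∀ u, Λ * ‖u‖ ≤ ‖M u‖) {w : PhaseVec N}
    (hw : w ∈ coneX N 2) : shear M w ∈ coneX N (1 / 20) := by
  have h := norm_shear_ge hM w hw
  change ‖yPart (shear M w)‖ ≤ 1 / 20 * ‖xPart (shear M w)‖
  rw [yPart_shear]
  nlinarith [norm_nonneg (xPart w)]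

theorem coneX_subset_coneX {α α' : ℝ} (h : α ≤ α') : coneX N α ⊆ coneX N α' := fun w hw =>
  le_trans (show ‖yPart w‖ ≤ α * ‖xPart w‖ from hw)
    (mul_le_mul_of_nonneg_right h (norm_nonneg _))

theorem comp_shear_mem_coneX (hΛ : 40 ≤ Λ) (hM : ∀ u, Λ * ‖u‖ ≤ ‖M u‖)
    (hA : Set.MapsTo A (coneX N (1 / 20)) (coneX N (1 / 10))) {w : PhaseVec N}
    (hw : w ∈ coneX N 2) : A (shear M w) ∈ coneX N 2 :=
  coneX_subset_coneX (by norm_num) (hA (shear_mem_coneX hΛ hM hw))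

/-- Horizontal vectors are expanded. -/
theorem norm_xPart_comp_shear_ge (hΛ : 40 ≤ Λ) (hM : ∀ u, Λ * ‖u‖ ≤ ‖M u‖)
    (hA : Set.MapsTo A (coneX N (1 / 20)) (coneX N (1 / 10))) (hA' : ∀ w, ‖w‖ ≤ 2 * ‖A w‖)
    {w : PhaseVec N} (hw : w ∈ coneX N 2) :
    Λ / 4 * ‖xPart w‖ ≤ ‖xPart (A (shear M w))‖ := by
  have h1 := norm_shear_ge hM w hw
  have h2 : ‖yPart (A (shear M w))‖ ≤ 1 / 10 * ‖xPart (A (shear M w))‖ :=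
    hA (shear_mem_coneX hΛ hM hw)
  have h3 := norm_le_add (A (shear M w))
  have h4 := hA' (shear M w)
  have h5 := norm_xPart_le (shear M w)
  -- The image lies in `𝓒^x_{1/10}`, so its norm is at most `11/10` of its `x`-part. The `x`-part is
  -- thus at least `(Λ - 2) / 2.2` times `‖xPart w‖`, and `Λ ≥ 40` leaves `Λ/4`.
  nlinarith [norm_nonneg (xPart w)]

/-- Vectors which end up outside the horizontal cone have been contracted. -/
theorem norm_comp_shear_le (hΛ : 40 ≤ Λ) (hM : ∀ u, Λ * ‖u‖ ≤ ‖M u‖)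
    (hA : Set.MapsTo A (coneX N (1 / 20)) (coneX N (1 / 10))) (hA' : ‖A‖ ≤ 2)
    {w : PhaseVec N} (hw : A (shear M w) ∉ coneX N 2) :
    ‖A (shear M w)‖ ≤ 84 / Λ * ‖w‖ := by
  have h1 : shear M w ∉ coneX N (1 / 20) := fun h =>
    hw (coneX_subset_coneX (by norm_num) (hA h))
  have h2 : 1 / 20 * ‖xPart (shear M w)‖ < ‖yPart (shear M w)‖ := not_le.1 h1
  have h3 := norm_le_add (shear M w)
  have h4 := A.le_of_opNorm_le hA' (shear M w)
  have h5 := norm_sub_norm_le (M (xPart w)) (M (xPart w) - yPart w)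
  rw [sub_sub_cancel] at h5
  rw [xPart_shear, yPart_shear] at h2 h3
  have h6 := hM (xPart w)
  have h7 := norm_yPart_le w
  -- Outside `𝓒^x_{1/20}` the `x`-part of `shear M w` is less than `20 ‖xPart w‖`, so `shear M w`
  -- has norm at most `21 ‖xPart w‖`.
  have h8 : ‖A (shear M w)‖ ≤ 42 * ‖xPart w‖ := by linarith
  -- Since `M (xPart w) - yPart w` is that short, `yPart w` must nearly cancel `M (xPart w)`: it has
  -- norm at least `(Λ - 20) ‖xPart w‖`.
  have h9 : Λ / 2 * ‖xPart w‖ ≤ ‖w‖ := by nlinarith [norm_nonneg (xPart w)]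
  calc ‖A (shear M w)‖ ≤ 42 * ‖xPart w‖ := h8
    _ = 84 / Λ * (Λ / 2 * ‖xPart w‖) := by field_simp; ring
    _ ≤ 84 / Λ * ‖w‖ := by gcongr

end Step

/-! ### Compositions of `n` steps -/

/-- A sequence `B` of products `B n = A (n - 1) ∘ shear (M (n - 1)) ∘ ⋯ ∘ A 0 ∘ shear (M 0)`
maps horizontal vectors to horizontal vectors, expanding them. -/
theorem iterate_shear_expands {N n : ℕ} {Λ : ℝ} (hΛ : 40 ≤ Λ)
    {M : ℕ → EuclideanSpace ℝ (Fin N) →L[ℝ] EuclideanSpace ℝ (Fin N)}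
    {A B : ℕ → PhaseVec N →L[ℝ] PhaseVec N} (hB0 : B 0 = ContinuousLinearMap.id ℝ _)
    (hB : ∀ i, B (i + 1) = A i ∘L shear (M i) ∘L B i)
    (hM : ∀ i < n, ∀ u, Λ * ‖u‖ ≤ ‖M i u‖)
    (hA : ∀ i, Set.MapsTo (A i) (coneX N (1 / 20)) (coneX N (1 / 10)))
    (hA' : ∀ i w, ‖w‖ ≤ 2 * ‖A i w‖) {w : PhaseVec N} (hw : w ∈ coneX N 2) :
    B n w ∈ coneX N 2 ∧ (Λ / 4) ^ n * ‖xPart w‖ ≤ ‖xPart (B n w)‖ := by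
  induction n with
  | zero => simp [hB0, hw]
  | succ n ih =>
    obtain ⟨h1, h2⟩ := ih fun i hi => hM i (hi.trans n.lt_succ_self)
    have hMn := hM n n.lt_succ_self
    rw [hB]
    refine ⟨comp_shear_mem_coneX hΛ hMn (hA n) h1, ?_⟩
    refine le_trans ?_ (norm_xPart_comp_shear_ge hΛ hMn (hA n) (hA' n) h1)
    rw [pow_succ', mul_assoc]
    gcongr
    exact h2

/-- Forward invariance of the cone, read backwards, puts all intermediate images outside it as well,
so the one-step contraction applies every time. -/
theorem iterate_shear_contracts {N n : ℕ} {Λ : ℝ} (hΛ : 40 ≤ Λ)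
    {M : ℕ → EuclideanSpace ℝ (Fin N) →L[ℝ] EuclideanSpace ℝ (Fin N)}
    {A B : ℕ → PhaseVec N →L[ℝ] PhaseVec N} (hB0 : B 0 = ContinuousLinearMap.id ℝ _)
    (hB : ∀ i, B (i + 1) = A i ∘L shear (M i) ∘L B i)
    (hM : ∀ i < n, ∀ u, Λ * ‖u‖ ≤ ‖M i u‖)
    (hA : ∀ i, Set.MapsTo (A i) (coneX N (1 / 20)) (coneX N (1 / 10)))
    (hA' : ∀ i, ‖A i‖ ≤ 2) {w : PhaseVec N} (hw : B n w ∉ coneX N 2) :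
    ‖B n w‖ ≤ (84 / Λ) ^ n * ‖w‖ := by
  induction n with
  | zero => simp [hB0]
  | succ n ih =>
    have hMn := hM n n.lt_succ_self
    rw [hB] at hw ⊢
    have h1 : B n w ∉ coneX N 2 := fun h => hw (comp_shear_mem_coneX hΛ hMn (hA n) h)
    have h2 := ih (fun i hi => hM i (hi.trans n.lt_succ_self)) h1
    refine (norm_comp_shear_le hΛ hMn (hA n) (hA' n) hw).trans ?_
    rw [pow_succ', mul_assoc]
    gcongr
    exact h2

/-! ### The chain rule on tori -/

theorem torusProj_surjective {ι : Type*} : Function.Surjective (torusProj (ι := ι)) := by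
  intro z
  choose u hu using fun i => QuotientAddGroup.mk_surjective (z i)
  exact ⟨WithLp.toLp 2 u, funext hu⟩

theorem IsTorusLift.comp {ι : Type*} {g h : Torus ι → Torus ι}
    {G H : EuclideanSpace ℝ ι → EuclideanSpace ℝ ι}
    (hH : IsTorusLift H h) (hG : IsTorusLift G g) : IsTorusLift (H ∘ G) (h ∘ g) := fun u => by
  simp only [Function.comp_apply, hH (G u), hG u]

section Deriv

variable {ι : Type*} [Fintype ι] {g h : Torus ι → Torus ι}

theorem torusDeriv_torusProj {G : EuclideanSpace ℝ ι → EuclideanSpace ℝ ι}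
    {A : EuclideanSpace ℝ ι →L[ℝ] EuclideanSpace ℝ ι} {u : EuclideanSpace ℝ ι}
    (hG : IsTorusLift G g) (hA : HasFDerivAt G A u) : torusDeriv g (torusProj u) = A :=
  HasTorusDerivAt.torusDeriv_eq ⟨G, u, hG, rfl, hA⟩

theorem TorusContDiff.comp {k : WithTop ℕ∞} (hh : TorusContDiff k h) (hg : TorusContDiff k g) :
    TorusContDiff k (h ∘ g) := by
  obtain ⟨H, hH, hH'⟩ := hh
  obtain ⟨G, hG, hG'⟩ := hg
  exact ⟨H ∘ G, hH.comp hG, hH'.comp hG'⟩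

theorem TorusContDiff.of_le {k l : WithTop ℕ∞} (hg : TorusContDiff l g) (hkl : k ≤ l) :
    TorusContDiff k g := by
  obtain ⟨G, hG, hG'⟩ := hg
  exact ⟨G, hG.of_le hkl, hG'⟩

theorem torusContDiff_id {k : WithTop ℕ∞} : TorusContDiff k (id : Torus ι → Torus ι) :=
  ⟨id, contDiff_id, fun _ => rfl⟩

theorem torusDeriv_id (z : Torus ι) :
    torusDeriv (id : Torus ι → Torus ι) z = ContinuousLinearMap.id ℝ _ := by
  obtain ⟨u, rfl⟩ := torusProj_surjective z
  exact torusDeriv_torusProj (G := id) (fun _ => rfl) (hasFDerivAt_id u)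

theorem torusDeriv_comp (hh : TorusContDiff 1 h) (hg : TorusContDiff 1 g) (z : Torus ι) :
    torusDeriv (h ∘ g) z = torusDeriv h (g z) ∘L torusDeriv g z := by
  obtain ⟨H, hH, hH'⟩ := hh
  obtain ⟨G, hG, hG'⟩ := hg
  obtain ⟨u, rfl⟩ := torusProj_surjective z
  have h1 := (hG.differentiable one_ne_zero u).hasFDerivAt
  have h2 := (hH.differentiable one_ne_zero (G u)).hasFDerivAt
  rw [torusDeriv_torusProj (hH'.comp hG') (h2.comp u h1), torusDeriv_torusProj hG' h1, ← hG' u,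
    torusDeriv_torusProj hH' h2]

/-- Lower bound for the derivative of a torus diffeomorphism, from a bound for the inverse of the
derivative. -/
theorem norm_le_mul_norm_torusDeriv {R : Torus ι ≃ Torus ι} (hR : TorusContDiff 1 R)
    (hR' : TorusContDiff 1 R.symm) {z : Torus ι} {c : ℝ} (hc : ‖(torusDeriv R z).inverse‖ ≤ c)
    (w : EuclideanSpace ℝ ι) : ‖w‖ ≤ c * ‖torusDeriv R z w‖ := by
  -- `ContinuousLinearMap.inverse` is `0` on a non-invertible map, so `hc` is informative only once
  -- the derivative of `R.symm` is shown to be a two-sided inverse.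
  have h1 := torusDeriv_comp hR' hR z
  have h2 := torusDeriv_comp hR hR' (R z)
  rw [Equiv.symm_comp_self, torusDeriv_id] at h1
  rw [Equiv.self_comp_symm, torusDeriv_id, Equiv.symm_apply_apply] at h2
  rw [ContinuousLinearMap.inverse_eq h2.symm h1.symm] at hc
  have h3 := ContinuousLinearMap.le_of_opNorm_le _ hc (torusDeriv R z w)
  rwa [← ContinuousLinearMap.comp_apply, ← h1] at h3

end Deriv

/-! ### Derivatives of the random iterates -/

section Iterate

variable {N : ℕ} {f : Torus (Fin N) → Torus (Fin N)}

theorem isTorusLift_baseMap {G : EuclideanSpace ℝ (Fin N) → EuclideanSpace ℝ (Fin N)}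
    (hG : IsTorusLift G f) : IsTorusLift
      (fun w : PhaseVec N => inlL N (G (xL N w) - yL N w) + inrL N (xL N w)) (baseMap f) := by
  intro w
  funext i
  rcases i with i | i
  · have := congrFun (hG (xPart w)) i
    simp only [torusProj] at this
    simp [torusProj, baseMap, xL_apply, yL_apply, this]
    rfl
  · simp [torusProj, baseMap, xL_apply]
    rfl

theorem TorusContDiff.baseMap {k : WithTop ℕ∞} (hf : TorusContDiff k f) :
    TorusContDiff k (baseMap f) := by
  obtain ⟨G, hG, hG'⟩ := hf
  exact ⟨_, by fun_prop, isTorusLift_baseMap hG'⟩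

theorem torusDeriv_baseMap (hf : TorusContDiff 1 f) (z : PhaseTorus N) :
    torusDeriv (baseMap f) z = shear (torusDeriv f z.x) := by
  obtain ⟨G, hG, hG'⟩ := hf
  obtain ⟨w, rfl⟩ := torusProj_surjective z
  have h1 := (hG.differentiable one_ne_zero (xL N w)).hasFDerivAt
  have h2 : torusDeriv f (PhaseTorus.x (torusProj w)) = fderiv ℝ G (xL N w) :=
    torusDeriv_torusProj hG' h1
  rw [h2]
  refine torusDeriv_torusProj (isTorusLift_baseMap hG') ?_
  exact ((inlL N).hasFDerivAt.comp w ((h1.comp w (xL N).hasFDerivAt).sub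
    (yL N).hasFDerivAt)).add ((inrL N).hasFDerivAt.comp w (xL N).hasFDerivAt)

variable {Ω₀ : Type*} {R : Ω₀ → PhaseTorus N ≃ PhaseTorus N} {ω : ℕ → Ω₀}

theorem randomIterate_succ (n : ℕ) :
    randomIterate f R ω (n + 1) = R (ω n) ∘ baseMap f ∘ randomIterate f R ω n := rfl

theorem torusContDiff_randomIterate {k : WithTop ℕ∞} (hf : TorusContDiff k f)
    (hR : ∀ a, TorusContDiff k (R a)) (n : ℕ) : TorusContDiff k (randomIterate f R ω n) := by
  induction n with
  | zero => exact torusContDiff_id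
  | succ n ih => exact (hR (ω n)).comp (hf.baseMap.comp ih)

theorem torusDeriv_randomIterate_succ (hf : TorusContDiff 1 f)
    (hR : ∀ a, TorusContDiff 1 (R a)) (n : ℕ) (z : PhaseTorus N) :
    torusDeriv (randomIterate f R ω (n + 1)) z =
      torusDeriv (R (ω n)) (baseMap f (randomIterate f R ω n z)) ∘L
        shear (torusDeriv f (randomIterate f R ω n z).x) ∘L
          torusDeriv (randomIterate f R ω n) z := by
  have h := torusContDiff_randomIterate (ω := ω) hf hR n
  rw [randomIterate_succ, torusDeriv_comp (hR _) (hf.baseMap.comp h),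
    torusDeriv_comp hf.baseMap h, torusDeriv_baseMap hf]
  rfl

end Iterate

/-! ### Sublevel sets of trigonometric polynomials of degree one -/

open Real in
/-- The set of angles where `A cos θ + B sin θ` is small. -/
theorem volume_abs_cos_add_sin_le {A B r t : ℝ} (hr : 0 < r) (hAB : r ^ 2 ≤ A ^ 2 + B ^ 2) :
    volume {θ ∈ Set.Icc 0 (2 * π) | |A * cos θ + B * sin θ| ≤ t} ≤
      ENNReal.ofReal (5 * π * (t / r)) := by
  -- With `ζ = B + iA` the function becomes `‖ζ‖ sin (θ + arg ζ)`.
  set ζ : ℂ := ⟨B, A⟩ with hζ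
  have hζn : ‖ζ‖ ^ 2 = A ^ 2 + B ^ 2 := by
    rw [← Complex.normSq_eq_norm_sq, Complex.normSq_apply]; ring
  have hrζ : r ≤ ‖ζ‖ := le_of_sq_le_sq (by linarith) (norm_nonneg _)
  have hg (θ : ℝ) : A * cos θ + B * sin θ = ‖ζ‖ * sin (θ + ζ.arg) := by
    have h1 : ‖ζ‖ * cos ζ.arg = B := Complex.norm_mul_cos_arg ζ
    have h2 : ‖ζ‖ * sin ζ.arg = A := Complex.norm_mul_sin_arg ζ
    rw [sin_add, ← h1, ← h2]; ring
  -- Since `θ + arg ζ` lies in `(-π, 3π]`, the nearest multiple `kπ` has `-1 ≤ k ≤ 3`. Jordan's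
  -- inequality `|sin x| ≥ (2/π)|x|` then gives five intervals of length `π t / r`.
  have hsub : {θ ∈ Set.Icc 0 (2 * π) | |A * cos θ + B * sin θ| ≤ t} ⊆
      ⋃ k ∈ Finset.Icc (-1 : ℤ) 3, Metric.closedBall (k * π - ζ.arg) (π / 2 * (t / r)) := by
    rintro θ ⟨⟨h0, h2⟩, ht⟩
    have hk := abs_sub_round ((θ + ζ.arg) / π)
    set k := round ((θ + ζ.arg) / π) with hkdef
    have hk1 : |θ + ζ.arg - k * π| ≤ π / 2 := by
      have : θ + ζ.arg - k * π = ((θ + ζ.arg) / π - k) * π := by field_simp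
      rw [this, abs_mul, abs_of_pos pi_pos]
      nlinarith [pi_pos]
    have hs : |sin (θ + ζ.arg - k * π)| = |sin (θ + ζ.arg)| := by
      rw [sin_sub_int_mul_pi, abs_mul]
      simp [abs_zpow]
    have h3 := mul_abs_le_abs_sin hk1
    have h4 : r * |sin (θ + ζ.arg)| ≤ t := by
      rw [hg, abs_mul, abs_norm] at ht
      exact le_trans (by gcongr) ht
    rw [hs] at h3
    have h5 : |θ + ζ.arg - k * π| ≤ π / 2 * (t / r) := by
      have h6 : |sin (θ + ζ.arg)| ≤ t / r := by rwa [le_div_iff₀' hr]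
      calc |θ + ζ.arg - k * π| = π / 2 * (2 / π * |θ + ζ.arg - k * π|) := by field_simp
        _ ≤ π / 2 * (t / r) := by gcongr; exact h3.trans h6
    have hk2 := abs_le.1 hk1
    have hz1 := Complex.neg_pi_lt_arg ζ
    have hz2 := Complex.arg_le_pi ζ
    have hk3 : (-2 : ℝ) < k := by nlinarith [pi_pos]
    have hk4 : (k : ℝ) < 4 := by nlinarith [pi_pos]
    have hk5 : -2 < k := by exact_mod_cast hk3
    have hk6 : k < 4 := by exact_mod_cast hk4
    simp only [Set.mem_iUnion, Finset.mem_Icc]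
    refine ⟨k, ⟨by lia, by lia⟩, ?_⟩
    rw [Metric.mem_closedBall, Real.dist_eq]
    convert h5 using 2
    ring
  refine (measure_mono hsub).trans ((measure_biUnion_finset_le _ _).trans ?_)
  simp only [Real.volume_closedBall, Finset.sum_const, Int.card_Icc]
  rw [nsmul_eq_mul]
  have : ((Int.toNat (3 + 1 - (-1)) : ℕ) : ENNReal) = ENNReal.ofReal 5 := by
    norm_num [show Int.toNat 5 = 5 from rfl]
  rw [this, ← ENNReal.ofReal_mul (by norm_num)]
  exact ENNReal.ofReal_le_ofReal (le_of_eq (by ring))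

/-! ### Averaging over the orthogonal group -/

theorem norm_cos_smul_add_sin_smul {V : Type*} [NormedAddCommGroup V] [InnerProductSpace ℝ V]
    {x y : V} (hx : ‖x‖ = 1) (hy : ‖y‖ = 1) (hxy : inner ℝ x y = 0)
    (θ : ℝ) : ‖Real.cos θ • x + Real.sin θ • y‖ = 1 := by
  rw [← sq_eq_sq₀ (norm_nonneg _) zero_le_one, norm_add_sq_real, norm_smul, norm_smul,
    inner_smul_left, inner_smul_right, hx, hy, hxy]
  simp

namespace OrthGroup

variable {V : Type*} [NormedAddCommGroup V] [InnerProductSpace ℝ V] [FiniteDimensional ℝ V]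

/-- The Haar probability measure of the orthogonal group. -/
abbrev haar (V : Type*) [NormedAddCommGroup V] [InnerProductSpace ℝ V] [FiniteDimensional ℝ V] :
    Measure (OrthGroup V) :=
  Measure.haarMeasure (⊤ : TopologicalSpace.PositiveCompacts (OrthGroup V))

instance isProbabilityMeasure_haar : IsProbabilityMeasure (haar V) :=
  ⟨Measure.haarMeasure_self⟩

/-- A right translate of the Haar measure is again a Haar probability measure, hence the same one.
Averaging needs this because the circle `W θ` multiplies `U` on the right. -/
instance isMulRightInvariant_haar : (haar V).IsMulRightInvariant where
  map_mul_right_eq_self g := by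
    have : IsProbabilityMeasure ((haar V).map (· * g)) :=
      Measure.isProbabilityMeasure_map (by fun_prop)
    exact Measure.isHaarMeasure_eq_of_isProbabilityMeasure _ _

/-- If the fraction of `θ` with `U W_θ ∈ S` is at most `c` for every `U`, then `S` has measure at
most `c`. -/
theorem haar_le_of_forall_volume_le {W : ℝ → OrthGroup V} (hW : Continuous W)
    {S : Set (OrthGroup V)} (hS : MeasurableSet S) {ℓ c : ℝ} (hℓ : 0 < ℓ)
    (h : ∀ U, volume {θ ∈ Set.Icc 0 ℓ | U * W θ ∈ S} ≤ ENNReal.ofReal c) :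
    haar V S ≤ ENNReal.ofReal (c / ℓ) := by
  have hmeas : Measurable fun p : ℝ × OrthGroup V => p.2 * W p.1 := by
    have : Continuous fun p : ℝ × OrthGroup V => p.2 * W p.1 := by fun_prop
    exact this.measurable
  have hind : Measurable fun p : ℝ × OrthGroup V => S.indicator (1 : OrthGroup V → ENNReal) (p.2 * W p.1) :=
    (measurable_one.indicator hS).comp hmeas
  -- By right invariance the integral over `U` is the same for every `θ`; Tonelli then reduces the
  -- bound to one slice `U` at a time.
  have h1 : ENNReal.ofReal ℓ * haar V S =
      ∫⁻ θ in Set.Icc 0 ℓ, ∫⁻ U, S.indicator (1 : OrthGroup V → ENNReal) (U * W θ) ∂haar V := by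
    have h2 (θ : ℝ) : ∫⁻ U, S.indicator (1 : OrthGroup V → ENNReal) (U * W θ) ∂haar V = haar V S := by
      rw [lintegral_mul_right_eq_self (fun U => S.indicator (1 : OrthGroup V → ENNReal) U),
        lintegral_indicator_one hS]
    simp [h2, mul_comm]
  have h3 (U : OrthGroup V) : ∫⁻ θ in Set.Icc 0 ℓ, S.indicator (1 : OrthGroup V → ENNReal) (U * W θ) ≤
      ENNReal.ofReal c := by
    have hms : MeasurableSet {θ | U * W θ ∈ S} :=
      (show Continuous fun θ => U * W θ by fun_prop).measurable hS
    have h4 : (fun θ => S.indicator (1 : OrthGroup V → ENNReal) (U * W θ)) =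
        {θ | U * W θ ∈ S}.indicator 1 := by
      funext θ
      simp [Set.indicator]
    rw [h4, lintegral_indicator_one hms, Measure.restrict_apply hms, Set.inter_comm]
    exact h U
  rw [lintegral_lintegral_swap hind.aemeasurable] at h1
  have h5 : ENNReal.ofReal ℓ * haar V S ≤ ENNReal.ofReal c := by
    rw [h1]
    calc _ ≤ ∫⁻ _U, ENNReal.ofReal c ∂haar V := lintegral_mono h3
      _ = ENNReal.ofReal c := by simp
  rw [ENNReal.ofReal_div_of_pos hℓ, ENNReal.le_div_iff_mul_le
    (Or.inl (by simpa using hℓ)) (Or.inl ENNReal.ofReal_ne_top), mul_comm]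
  exact h5

/-- The reflection in the hyperplane orthogonal to a unit vector. -/
def reflect (x : V) (hx : ‖x‖ = 1) : OrthGroup V :=
  ⟨1 - (2 : ℝ) • InnerProductSpace.rankOne ℝ x x, by
    have hs : star (1 - (2 : ℝ) • InnerProductSpace.rankOne ℝ x x : V →L[ℝ] V) =
        1 - (2 : ℝ) • InnerProductSpace.rankOne ℝ x x := by
      rw [ContinuousLinearMap.star_eq_adjoint, map_sub, map_smul,
        InnerProductSpace.adjoint_rankOne, ← ContinuousLinearMap.star_eq_adjoint, star_one]
    have hi : InnerProductSpace.rankOne ℝ x x * InnerProductSpace.rankOne ℝ x x =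
        InnerProductSpace.rankOne ℝ x x := InnerProductSpace.isIdempotentElem_rankOne_self hx
    have hq : (1 - (2 : ℝ) • InnerProductSpace.rankOne ℝ x x : V →L[ℝ] V) *
        (1 - (2 : ℝ) • InnerProductSpace.rankOne ℝ x x) = 1 := by
      rw [mul_sub, sub_mul, sub_mul, smul_mul_smul_comm, hi, one_mul, mul_one, one_mul]
      module
    rw [Unitary.mem_iff, hs]
    exact ⟨hq, hq⟩⟩

theorem reflect_apply (x : V) (hx : ‖x‖ = 1) (w : V) :
    (reflect x hx : V →L[ℝ] V) w = w - (2 * inner ℝ x w) • x := by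
  simp [reflect, smul_smul]

variable {x y : V}

/-- A circle of reflections of the plane spanned by two orthonormal vectors. -/
def planeReflect (hx : ‖x‖ = 1) (hy : ‖y‖ = 1) (hxy : inner ℝ x y = 0) (θ : ℝ) : OrthGroup V :=
  -- The half angle makes the images of `x` and `y` trigonometric of degree one in `θ`.
  reflect (Real.cos (θ / 2) • x + Real.sin (θ / 2) • y)
    (norm_cos_smul_add_sin_smul hx hy hxy _)

section planeReflect

variable (hx : ‖x‖ = 1) (hy : ‖y‖ = 1) (hxy : inner ℝ x y = 0)

theorem continuous_planeReflect : Continuous (planeReflect hx hy hxy) := by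
  refine Continuous.subtype_mk ?_ _
  refine continuous_clm_apply.2 fun w => ?_
  simp only [sub_apply, smul_apply, InnerProductSpace.rankOne_apply]
  fun_prop

theorem planeReflect_apply_left (θ : ℝ) : (planeReflect hx hy hxy θ : V →L[ℝ] V) x =
    -(Real.cos θ • x + Real.sin θ • y) := by
  rw [planeReflect, reflect_apply, inner_add_left, inner_smul_left, inner_smul_left,
    real_inner_self_eq_norm_sq, hx, real_inner_comm, hxy]
  have h1 : Real.cos θ = 2 * Real.cos (θ / 2) ^ 2 - 1 := by
    rw [← Real.cos_two_mul]; congr 1; ring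
  have h2 : Real.sin θ = 2 * Real.sin (θ / 2) * Real.cos (θ / 2) := by
    rw [← Real.sin_two_mul]; congr 1; ring
  rw [h1, h2]
  simp only [conj_trivial]
  module

theorem planeReflect_apply_right (θ : ℝ) : (planeReflect hx hy hxy θ : V →L[ℝ] V) y =
    -(Real.sin θ • x) + Real.cos θ • y := by
  rw [planeReflect, reflect_apply, inner_add_left, inner_smul_left, inner_smul_left,
    real_inner_self_eq_norm_sq, hy, hxy]
  have h1 : Real.cos θ = 1 - 2 * Real.sin (θ / 2) ^ 2 := by
    rw [← Real.cos_two_mul_eq_one_sub]; congr 1; ring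
  have h2 : Real.sin θ = 2 * Real.sin (θ / 2) * Real.cos (θ / 2) := by
    rw [← Real.sin_two_mul]; congr 1; ring
  rw [h1, h2]
  simp only [conj_trivial]
  module

theorem planeReflect_apply_of_inner_eq_zero (θ : ℝ) {w : V} (hxw : inner ℝ x w = 0)
    (hyw : inner ℝ y w = 0) : (planeReflect hx hy hxy θ : V →L[ℝ] V) w = w := by
  rw [planeReflect, reflect_apply, inner_add_left, inner_smul_left, inner_smul_left, hxw, hyw]
  simp

end planeReflect

end OrthGroup

/-! ### Measure of the set of planes that come close to a complementary subspace -/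

/-- Projection along a compact factor is a closed map. This yields the measurability of sets defined
by the existence of a unit vector. -/
theorem IsCompact.isClosed_setOf_exists_mem {X Y : Type*} [TopologicalSpace X]
    [TopologicalSpace Y] {K : Set Y} (hK : IsCompact K) {p : X → Y → Prop}
    (hp : IsClosed {q : X × Y | p q.1 q.2}) : IsClosed {x | ∃ y ∈ K, p x y} := by
  have : CompactSpace K := isCompact_iff_compactSpace.1 hK
  have h1 : IsClosed {q : X × K | p q.1 q.2} :=
    hp.preimage (continuous_fst.prodMk (continuous_subtype_val.comp continuous_snd))
  convert! isClosedMap_fst_of_compactSpace _ h1 using 1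
  ext x
  constructor
  · rintro ⟨y, hy, h⟩
    exact ⟨(x, ⟨y, hy⟩), h, rfl⟩
  · rintro ⟨⟨x', y, hy⟩, h, rfl⟩
    exact ⟨y, hy, h⟩

/-- `N - 1` vectors in `ℝ^N` have a common unit normal vector. -/
theorem EuclideanSpace.exists_norm_eq_one_inner_eq_zero {ι : Type*} [Fintype ι]
    (w : ι → EuclideanSpace ℝ ι) (j : ι) :
    ∃ a : EuclideanSpace ℝ ι, ‖a‖ = 1 ∧ ∀ i ≠ j, inner ℝ a (w i) = 0 := by
  classical
  -- The zero in position `j` prevents surjectivity, hence injectivity; a kernel vector is the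
  -- required normal.
  let φ : EuclideanSpace ℝ ι →ₗ[ℝ] (ι → ℝ) :=
    LinearMap.pi fun i => if i = j then 0 else (innerSL ℝ (w i)).toLinearMap
  have h1 : ¬ Function.Surjective φ := fun h => by
    obtain ⟨a, ha⟩ := h (Pi.single j 1)
    simpa [φ] using congrFun ha j
  rw [← LinearMap.injective_iff_surjective_of_finrank_eq_finrank (by simp),
    injective_iff_map_eq_zero] at h1
  push Not at h1
  obtain ⟨a, ha, ha0⟩ := h1
  refine ⟨‖a‖⁻¹ • a, ?_, fun i hi => ?_⟩
  · rw [norm_smul, norm_inv, norm_norm, inv_mul_cancel₀ (norm_ne_zero_iff.2 ha0)]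
  · have h2 := congrFun ha i
    rw [inner_smul_left, real_inner_comm]
    simp only [φ, LinearMap.pi_apply, if_neg hi] at h2
    simp [show inner ℝ (w i) a = 0 from h2]

/-- The expansion of the norm in the orthonormal basis obtained by rotating the standard one. -/
theorem OrthGroup.norm_sq_eq_sum_inner {ι : Type*} [Fintype ι] [DecidableEq ι]
    (U : OrthGroup (EuclideanSpace ℝ ι)) (b : EuclideanSpace ℝ ι) :
    ‖b‖ ^ 2 = ∑ p, inner ℝ b ((U : EuclideanSpace ℝ ι →L[ℝ] EuclideanSpace ℝ ι)
      (EuclideanSpace.single p 1)) ^ 2 := by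
  have h1 := ((EuclideanSpace.basisFun ι ℝ).map
    (Unitary.linearIsometryEquiv (𝕜 := ℝ) (H := EuclideanSpace ℝ ι) U)).sum_sq_inner_left b
  rw [← h1]
  refine Finset.sum_congr rfl fun p _ => ?_
  simp
  rfl

section Transversality

variable {N : ℕ} (T : PhaseVec N →L[ℝ] EuclideanSpace ℝ (Fin N))

/-- The rotations `U` for which some unit vector `(c, 0)` with `c_j` not small has small image
under `T U`. -/
def nearKernel (ε : ℝ) (j : Fin N) : Set (OrthGroup (PhaseVec N)) :=
  {U | ∃ c ∈ Metric.sphere (0 : EuclideanSpace ℝ (Fin N)) 1, 1 ≤ N * c j ^ 2 ∧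
    ‖T ((U : PhaseVec N →L[ℝ] PhaseVec N) (inlL N c))‖ ≤ ε}

/-- The rotations `U` for which some unit normal vector `a` to the vectors `T U e_i`, `i ≠ j`,
has a large component in the images of the `j`-th horizontal and `k`-th vertical directions. -/
def largeNormal (s : ℝ) (j k : Fin N) : Set (OrthGroup (PhaseVec N)) :=
  {U | ∃ a ∈ Metric.sphere (0 : EuclideanSpace ℝ (Fin N)) 1,
    (∀ i ≠ j, inner ℝ a (T ((U : PhaseVec N →L[ℝ] PhaseVec N)
      (EuclideanSpace.single (Sum.inl i) 1))) = 0) ∧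
    s ^ 2 ≤ N * (inner ℝ a (T ((U : PhaseVec N →L[ℝ] PhaseVec N)
        (EuclideanSpace.single (Sum.inl j) 1))) ^ 2 +
      inner ℝ a (T ((U : PhaseVec N →L[ℝ] PhaseVec N)
        (EuclideanSpace.single (Sum.inr k) 1))) ^ 2)}

theorem isClosed_nearKernel (ε : ℝ) (j : Fin N) : IsClosed (nearKernel T ε j) := by
  refine (isCompact_sphere _ _).isClosed_setOf_exists_mem ?_
  simp only [Set.ofPred_and]
  refine IsClosed.inter (isClosed_le (by fun_prop) (by fun_prop))
    (isClosed_le (by fun_prop) (by fun_prop))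

theorem isClosed_largeNormal (s : ℝ) (j k : Fin N) : IsClosed (largeNormal T s j k) := by
  refine (isCompact_sphere _ _).isClosed_setOf_exists_mem ?_
  simp only [Set.ofPred_and, Set.ofPred_forall]
  refine IsClosed.inter ?_ (isClosed_le (by fun_prop) (by fun_prop))
  exact isClosed_iInter fun i => isClosed_iInter fun _ => isClosed_eq (by fun_prop) (by fun_prop)

theorem inlL_eq_sum (c : EuclideanSpace ℝ (Fin N)) :
    inlL N c = ∑ i, c i • EuclideanSpace.single (Sum.inl i) (1 : ℝ) := by
  ext (p | p) <;> simp [Pi.single_apply]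

variable {T}

/-- Being injective, `T ∘ inlL` is onto, so `a = T (u, 0)` with `s ‖u‖ ≤ ‖a‖`. Pairing `a` with
itself through the adjoint and Cauchy–Schwarz give the bound. -/
theorem norm_adjoint_ge {s : ℝ} (hs : 0 < s) (hT : ∀ u, s * ‖u‖ ≤ ‖T (inlL N u)‖)
    (a : EuclideanSpace ℝ (Fin N)) : s * ‖a‖ ≤ ‖ContinuousLinearMap.adjoint T a‖ := by
  have hinj : Function.Injective (T ∘L inlL N).toLinearMap := by
    rw [injective_iff_map_eq_zero]
    intro u hu
    have h1 := hT u
    rw [show T (inlL N u) = 0 from hu, norm_zero] at h1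
    exact norm_le_zero_iff.1 (nonpos_of_mul_nonpos_right h1 hs)
  obtain ⟨u, hu⟩ := LinearMap.surjective_of_injective hinj a
  have hu' : T (inlL N u) = a := hu
  have h1 : ‖inlL N u‖ = ‖u‖ := by
    rw [← sq_eq_sq₀ (norm_nonneg _) (norm_nonneg _), PhaseVec.norm_sq_eq]
    simp
  have h2 : ‖a‖ ^ 2 ≤ ‖ContinuousLinearMap.adjoint T a‖ * ‖u‖ := by
    rw [← real_inner_self_eq_norm_sq, ← h1]
    nth_rewrite 2 [← hu']
    rw [← ContinuousLinearMap.adjoint_inner_left]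
    exact real_inner_le_norm _ _
  have h3 := hT u
  rw [hu'] at h3
  rcases (norm_nonneg a).eq_or_lt with h0 | h0
  · rw [← h0, mul_zero]
    exact norm_nonneg _
  · refine le_of_mul_le_mul_right ?_ h0
    nlinarith [norm_nonneg (ContinuousLinearMap.adjoint T a)]

/-- Two pigeonhole arguments: some `c_j²` is at least `1/N`, and the coordinates of the adjoint
image of the normal `a` in the rotated basis cannot all be small. -/
theorem exists_mem_nearKernel_inter_largeNormal {s ε : ℝ} (hs : 0 < s)
    (hT : ∀ u, s * ‖u‖ ≤ ‖T (inlL N u)‖) {U : OrthGroup (PhaseVec N)}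
    {c : EuclideanSpace ℝ (Fin N)} (hc : ‖c‖ = 1)
    (hε : ‖T ((U : PhaseVec N →L[ℝ] PhaseVec N) (inlL N c))‖ ≤ ε) :
    ∃ j k, U ∈ nearKernel T ε j ∩ largeNormal T s j k := by
  have hc2 : ∑ i, c i ^ 2 = 1 := by
    have := EuclideanSpace.norm_sq_eq c
    rw [hc] at this
    simpa using this.symm
  have hj : ∃ j, 1 ≤ N * c j ^ 2 := by
    by_contra! h
    have hN : Nonempty (Fin N) := by
      by_contra h'
      rw [not_nonempty_iff] at h'
      simp at hc2
    have h1 : ∑ i, (N * c i ^ 2) < ∑ _i : Fin N, (1 : ℝ) :=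
      Finset.sum_lt_sum_of_nonempty Finset.univ_nonempty fun i _ => h i
    rw [← Finset.mul_sum, hc2] at h1
    simp at h1
  obtain ⟨j, hj⟩ := hj
  obtain ⟨a, ha, ha0⟩ := EuclideanSpace.exists_norm_eq_one_inner_eq_zero
    (fun i => T ((U : PhaseVec N →L[ℝ] PhaseVec N) (EuclideanSpace.single (Sum.inl i) 1))) j
  have h1 := norm_adjoint_ge hs hT a
  rw [ha, mul_one] at h1
  have h2 := OrthGroup.norm_sq_eq_sum_inner U (ContinuousLinearMap.adjoint T a)
  simp only [ContinuousLinearMap.adjoint_inner_left, Fintype.sum_sum_type] at h2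
  -- Among the horizontal coordinates only the `j`-th survives, by the choice of `a`.
  rw [Finset.sum_eq_single j (fun i _ hi => by rw [ha0 i hi]; simp) (by simp)] at h2
  set A := inner ℝ a (T ((U : PhaseVec N →L[ℝ] PhaseVec N)
    (EuclideanSpace.single (Sum.inl j) 1))) with hA
  have h3 : s ^ 2 ≤ ‖ContinuousLinearMap.adjoint T a‖ ^ 2 := by gcongr
  have hk : ∃ k, s ^ 2 ≤ N * (A ^ 2 + inner ℝ a (T ((U : PhaseVec N →L[ℝ] PhaseVec N)
      (EuclideanSpace.single (Sum.inr k) 1))) ^ 2) := by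
    by_contra! h
    have h4 := Finset.sum_lt_sum_of_nonempty (⟨j, Finset.mem_univ j⟩) fun i _ => h i
    rw [← Finset.mul_sum, Finset.sum_add_distrib] at h4
    simp only [Finset.sum_const, Finset.card_univ, Fintype.card_fin, nsmul_eq_mul] at h4
    have hN : (1 : ℝ) ≤ N := by exact_mod_cast (Nat.one_le_iff_ne_zero.2 fun h => by
      subst h; exact j.elim0)
    have h5 := lt_of_mul_lt_mul_left h4 (by positivity)
    nlinarith [sq_nonneg A]
  obtain ⟨k, hk⟩ := hk
  exact ⟨j, k, ⟨c, by simpa using hc, hj, hε⟩, ⟨a, by simpa using ha, ha0, hk⟩⟩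

/-- Along the circle `U * W θ` only `e_j` and the vertical `e_k` move, so one normal `a` serves all
`θ`. Its pairing with the image of `e_j` is a trigonometric polynomial of amplitude at least `s /
√N`, which must be at most `√N ε` in absolute value. -/
theorem haar_nearKernel_inter_largeNormal_le {s ε : ℝ} (hs : 0 < s) (j k : Fin N) : OrthGroup.haar (PhaseVec N) (nearKernel T ε j ∩ largeNormal T s j k) ≤
      ENNReal.ofReal (5 / 2 * (N * ε / s)) := by
  have hN : (0 : ℝ) < N := by exact_mod_cast j.pos
  have hx : ‖(EuclideanSpace.single (Sum.inl j) 1 : PhaseVec N)‖ = 1 := by simp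
  have hy : ‖(EuclideanSpace.single (Sum.inr k) 1 : PhaseVec N)‖ = 1 := by simp
  have hxy : inner ℝ (EuclideanSpace.single (Sum.inl j) 1 : PhaseVec N)
      (EuclideanSpace.single (Sum.inr k) 1) = 0 := by
    simp [EuclideanSpace.inner_single_left]
  have hπ := Real.pi_pos
  have key := OrthGroup.haar_le_of_forall_volume_le
    (OrthGroup.continuous_planeReflect hx hy hxy)
    ((isClosed_nearKernel T ε j).inter (isClosed_largeNormal T s j k)).measurableSet
    (ℓ := 2 * Real.pi) (c := 5 * Real.pi * (N * ε / s)) (by positivity) ?_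
  · convert! key using 2
    field_simp
  intro U
  have hl := OrthGroup.planeReflect_apply_left hx hy hxy
  have hr := OrthGroup.planeReflect_apply_right hx hy hxy
  have ho (θ : ℝ) (i : Fin N) (hi : i ≠ j) :=
    OrthGroup.planeReflect_apply_of_inner_eq_zero hx hy hxy θ
      (w := EuclideanSpace.single (Sum.inl i) 1)
      (by simp [EuclideanSpace.inner_single_left, hi.symm])
      (by simp [EuclideanSpace.inner_single_left])
  set W := OrthGroup.planeReflect hx hy hxy with hW
  -- An empty slice is trivial; otherwise `a` is taken from a single `θ₀` and kept fixed.
  rcases Set.eq_empty_or_nonempty {θ ∈ Set.Icc 0 (2 * Real.pi) |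
    U * W θ ∈ nearKernel T ε j ∩ largeNormal T s j k} with h0 | ⟨θ₀, -, -, a, ha, ha0, has⟩
  · rw [h0, measure_empty]
    exact zero_le
  set A := inner ℝ a (T ((U : PhaseVec N →L[ℝ] PhaseVec N)
    (EuclideanSpace.single (Sum.inl j) 1))) with hA
  set B := inner ℝ a (T ((U : PhaseVec N →L[ℝ] PhaseVec N)
    (EuclideanSpace.single (Sum.inr k) 1))) with hB
  have hmul (θ : ℝ) (w : PhaseVec N) : ((U * W θ : OrthGroup (PhaseVec N)) :
      PhaseVec N →L[ℝ] PhaseVec N) w =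
        (U : PhaseVec N →L[ℝ] PhaseVec N) ((W θ : PhaseVec N →L[ℝ] PhaseVec N) w) := rfl
  have hz (i : Fin N) (hi : i ≠ j) : inner ℝ a (T ((U : PhaseVec N →L[ℝ] PhaseVec N)
      (EuclideanSpace.single (Sum.inl i) 1))) = 0 := by
    have := ha0 i hi
    rwa [hmul, ho θ₀ i hi] at this
  have hleft (θ : ℝ) : inner ℝ a (T ((U : PhaseVec N →L[ℝ] PhaseVec N)
      ((W θ : PhaseVec N →L[ℝ] PhaseVec N) (EuclideanSpace.single (Sum.inl j) 1)))) =
        -(A * Real.cos θ + B * Real.sin θ) := by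
    rw [hl, map_neg, map_add, map_smul, map_smul, map_neg, map_add, map_smul, map_smul,
      inner_neg_right, inner_add_right, inner_smul_right, inner_smul_right, ← hA, ← hB]
    ring
  have hright (θ : ℝ) : inner ℝ a (T ((U : PhaseVec N →L[ℝ] PhaseVec N)
      ((W θ : PhaseVec N →L[ℝ] PhaseVec N) (EuclideanSpace.single (Sum.inr k) 1)))) =
        -(A * Real.sin θ) + B * Real.cos θ := by
    rw [hr, map_add, map_neg, map_smul, map_smul, map_add, map_neg, map_smul, map_smul,
      inner_add_right, inner_neg_right, inner_smul_right, inner_smul_right, ← hA, ← hB]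
    ring
  rw [hmul, hmul, hleft, hright] at has
  -- The bound is known at `θ₀`; `W θ₀` acts orthogonally on the pair `(A, B)` and so preserves `A²
  -- + B²`.
  have hAB : (s / √N) ^ 2 ≤ A ^ 2 + B ^ 2 := by
    rw [div_pow, Real.sq_sqrt hN.le, div_le_iff₀' hN]
    have h1 : (-(A * Real.cos θ₀ + B * Real.sin θ₀)) ^ 2 +
        (-(A * Real.sin θ₀) + B * Real.cos θ₀) ^ 2 =
          (A ^ 2 + B ^ 2) * (Real.sin θ₀ ^ 2 + Real.cos θ₀ ^ 2) := by ring
    rwa [h1, Real.sin_sq_add_cos_sq, mul_one] at has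
  have hsub : {θ ∈ Set.Icc 0 (2 * Real.pi) |
      U * W θ ∈ nearKernel T ε j ∩ largeNormal T s j k} ⊆
        {θ ∈ Set.Icc 0 (2 * Real.pi) | |A * Real.cos θ + B * Real.sin θ| ≤ √N * ε} := by
    rintro θ ⟨hθ, ⟨c, -, hcj, hcε⟩, -⟩
    refine ⟨hθ, ?_⟩
    have h1 : inner ℝ a (T (((U * W θ : OrthGroup (PhaseVec N)) :
        PhaseVec N →L[ℝ] PhaseVec N) (inlL N c))) =
          -(c j * (A * Real.cos θ + B * Real.sin θ)) := by
      rw [inlL_eq_sum, map_sum, map_sum, inner_sum, Finset.sum_eq_single j]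
      · rw [map_smul, map_smul, inner_smul_right, hmul, hleft]
        ring
      · intro i _ hi
        rw [map_smul, map_smul, inner_smul_right, hmul, ho θ i hi, hz i hi, mul_zero]
      · simp
    have h2 := (abs_real_inner_le_norm a _).trans (mul_le_mul_of_nonneg_left hcε (norm_nonneg a))
    rw [h1, abs_neg, abs_mul, mem_sphere_zero_iff_norm.1 ha, one_mul] at h2
    have h3 : 1 ≤ √N * |c j| := by
      refine le_of_sq_le_sq ?_ (by positivity)
      rwa [mul_pow, Real.sq_sqrt hN.le, sq_abs, one_pow]
    calc |A * Real.cos θ + B * Real.sin θ|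
        ≤ (√N * |c j|) * |A * Real.cos θ + B * Real.sin θ| :=
          le_mul_of_one_le_left (abs_nonneg _) h3
      _ = √N * (|c j| * |A * Real.cos θ + B * Real.sin θ|) := by ring
      _ ≤ √N * ε := by gcongr
  refine (measure_mono hsub).trans ((volume_abs_cos_add_sin_le (by positivity) hAB).trans ?_)
  refine ENNReal.ofReal_le_ofReal (le_of_eq ?_)
  have h1 : √N * ε / (s / √N) = (√N * √N) * ε / s := by field_simp
  rw [h1, Real.mul_self_sqrt hN.le]

/-- The set of `N`-planes that contain a unit vector with small image under `T` has small
volume, if `T` is bounded below on the horizontal plane. -/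
theorem grassmannLeb_exists_norm_le {s ε : ℝ} (hs : 0 < s)
    (hT : ∀ u, s * ‖u‖ ≤ ‖T (inlL N u)‖) :
    grassmannLeb N {E | ∃ v ∈ Metric.sphere (0 : PhaseVec N) 1, v ∈ E.1 ∧ ‖T v‖ ≤ ε} ≤
      ENNReal.ofReal (5 / 2 * N ^ 3 * (ε / s)) := by
  have hcl : IsClosed {E : Grassmann (PhaseVec N) N |
      ∃ v ∈ Metric.sphere (0 : PhaseVec N) 1, v ∈ E.1 ∧ ‖T v‖ ≤ ε} := by
    refine (isCompact_sphere _ _).isClosed_setOf_exists_mem ?_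
    simp only [Set.ofPred_and]
    refine IsClosed.inter ?_ (isClosed_le (by fun_prop) (by fun_prop))
    have hp : Continuous fun E : Grassmann (PhaseVec N) N => E.1.starProjection :=
      continuous_induced_dom
    have h1 : IsClosed {q : Grassmann (PhaseVec N) N × PhaseVec N |
        q.1.1.starProjection q.2 = q.2} :=
      isClosed_eq ((hp.comp continuous_fst).clm_apply continuous_snd) continuous_snd
    convert! h1 using 1
    ext q
    exact Submodule.starProjection_eq_self_iff.symm
  have hspan : (horizontalPlane N).1 ≤ LinearMap.range (inlL N).toLinearMap := by
    refine Submodule.span_le.2 ?_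
    rintro _ ⟨i, rfl⟩
    refine ⟨EuclideanSpace.single i 1, ?_⟩
    ext (p | p) <;> simp
  rw [grassmannLeb, Grassmann.leb,
    Measure.map_apply (Grassmann.continuous_rotate _).measurable hcl.measurableSet]
  have hsub : (fun U => Grassmann.rotate U (horizontalPlane N)) ⁻¹' {E |
      ∃ v ∈ Metric.sphere (0 : PhaseVec N) 1, v ∈ E.1 ∧ ‖T v‖ ≤ ε} ⊆
        ⋃ j, ⋃ k, nearKernel T ε j ∩ largeNormal T s j k := by
    rintro U ⟨_, hv, ⟨w, hw, rfl⟩, hvε⟩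
    obtain ⟨c, rfl⟩ := hspan hw
    have h1 : ‖inlL N c‖ = 1 := by
      rw [← mem_sphere_zero_iff_norm.1 hv]
      exact ((Unitary.linearIsometryEquiv (𝕜 := ℝ) (H := PhaseVec N) U).norm_map _).symm
    have h2 : ‖c‖ = 1 := by
      have := PhaseVec.norm_sq_eq (inlL N c)
      rw [h1, xPart_inlL, yPart_inlL, norm_zero] at this
      rw [← sq_eq_sq₀ (norm_nonneg _) zero_le_one]
      linarith
    obtain ⟨j, k, h⟩ := exists_mem_nearKernel_inter_largeNormal hs hT h2 hvε
    exact Set.mem_iUnion₂.2 ⟨j, k, h⟩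
  refine (measure_mono hsub).trans ?_
  -- The union over the `N²` pairs `(j, k)` raises the factor `N` to `N³`.
  calc OrthGroup.haar (PhaseVec N) (⋃ j, ⋃ k, nearKernel T ε j ∩ largeNormal T s j k)
      ≤ ∑ j, ∑ k, OrthGroup.haar (PhaseVec N) (nearKernel T ε j ∩ largeNormal T s j k) :=
        (measure_iUnion_fintype_le _ _).trans
          (Finset.sum_le_sum fun j _ => measure_iUnion_fintype_le _ _)
    _ ≤ ∑ _j : Fin N, ∑ _k : Fin N, ENNReal.ofReal (5 / 2 * (N * ε / s)) := by
        gcongr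
        exact haar_nearKernel_inter_largeNormal_le hs _ _
    _ = ENNReal.ofReal (5 / 2 * N ^ 3 * (ε / s)) := by
        simp only [Finset.sum_const, Finset.card_univ, Fintype.card_fin, nsmul_eq_mul]
        rw [← ENNReal.ofReal_natCast, ← ENNReal.ofReal_mul (by positivity),
          ← ENNReal.ofReal_mul (by positivity)]
        congr 1
        ring

end Transversality

/-! ### The main estimate -/

/-- The bound for a single realization of the noise. -/
theorem grassmannLeb_not_subset_coneX_le {N : ℕ} {f : Torus (Fin N) → Torus (Fin N)} {Ω₀ : Type*}
    {R : Ω₀ → PhaseTorus N ≃ PhaseTorus N} {ω : ℕ → Ω₀} {Λ : ℝ} (hΛ : 40 ≤ Λ)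
    (hf : TorusContDiff 1 f) (hR : ∀ a, IsC2VolDiffeo (R a)) (hω : ∀ i, ConeCondition (R (ω i)))
    {n : ℕ} {z : PhaseTorus N}
    (hz : ∀ i < n, ∀ u, Λ * ‖u‖ ≤ ‖torusDeriv f (randomIterate f R ω i z).x u‖) :
    grassmannLeb N {E | ¬ ((E.1.map (torusDeriv (randomIterate f R ω n) z).toLinearMap :
        Submodule ℝ (PhaseVec N)) : Set (PhaseVec N)) ⊆ coneX N 2} ≤
      ENNReal.ofReal (5 / 2 * N ^ 3 * (336 / Λ ^ 2) ^ n) := by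
  have hΛ0 : 0 < Λ := by linarith
  have hR1 (a : Ω₀) : TorusContDiff 1 (R a) := (hR a).contDiff.of_le one_le_two
  have hR1' (a : Ω₀) : TorusContDiff 1 (R a).symm := (hR a).contDiff_symm.of_le one_le_two
  set B : ℕ → PhaseVec N →L[ℝ] PhaseVec N := fun i => torusDeriv (randomIterate f R ω i) z
  set A : ℕ → PhaseVec N →L[ℝ] PhaseVec N :=
    fun i => torusDeriv (R (ω i)) (baseMap f (randomIterate f R ω i z))
  have hB0 : B 0 = ContinuousLinearMap.id ℝ _ := torusDeriv_id z
  have hB (i : ℕ) : B (i + 1) =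
      A i ∘L shear (torusDeriv f (randomIterate f R ω i z).x) ∘L B i :=
    torusDeriv_randomIterate_succ hf hR1 i z
  have hA (i : ℕ) : Set.MapsTo (A i) (coneX N (1 / 20)) (coneX N (1 / 10)) := (hω i).mapsTo _
  have hA' (i : ℕ) (w : PhaseVec N) : ‖w‖ ≤ 2 * ‖A i w‖ :=
    norm_le_mul_norm_torusDeriv (hR1 _) (hR1' _) ((hω i).norm_inverse_le _) w
  have hT (u : EuclideanSpace ℝ (Fin N)) : (Λ / 4) ^ n * ‖u‖ ≤ ‖(xL N ∘L B n) (inlL N u)‖ :=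
    (iterate_shear_expands hΛ hB0 hB hz hA hA' (w := inlL N u) (by simp [coneX])).2
  -- Here `ε / s = ((84/Λ) / (Λ/4))^n = (336/Λ²)^n`.
  refine (measure_mono ?_).trans
    ((grassmannLeb_exists_norm_le (T := xL N ∘L B n) (s := (Λ / 4) ^ n) (ε := (84 / Λ) ^ n)
      (by positivity) hT).trans (ENNReal.ofReal_le_ofReal (le_of_eq ?_)))
  · intro E hE
    obtain ⟨_, ⟨w, hw, rfl⟩, hwc⟩ := Set.not_subset.1 hE
    change B n w ∉ coneX N 2 at hwc
    have h1 := iterate_shear_contracts hΛ hB0 hB hz hA (fun i => (hω i).norm_le _) hwc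
    have hw0 : 0 < ‖w‖ := by
      refine norm_pos_iff.2 ?_
      rintro rfl
      rw [map_zero] at hwc
      exact hwc (by simp [coneX, ← xL_apply, ← yL_apply])
    refine ⟨‖w‖⁻¹ • w, ?_, E.1.smul_mem _ hw, ?_⟩
    · rw [mem_sphere_zero_iff_norm, norm_smul, norm_inv, norm_norm, inv_mul_cancel₀ hw0.ne']
    · rw [map_smul, norm_smul, norm_inv, norm_norm, inv_mul_le_iff₀ hw0, mul_comm]
      exact (norm_xPart_le _).trans h1
  · rw [← div_pow]
    congr 2
    field_simp
    ring

/-- Hadamard's inequality with `N = m + 1`: the factor `L^m` of the determinant bound cancels the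
one in `(C₀ L)^m`. -/
theorem mul_norm_le_of_lt_abs_det {m : ℕ} {C₀ L β : ℝ} (hC₀ : 0 < C₀) (hL : 1 ≤ L)
    {M : EuclideanSpace ℝ (Fin (m + 1)) →L[ℝ] EuclideanSpace ℝ (Fin (m + 1))}
    (hM : ‖M‖ ≤ C₀ * L) (hdet : L ^ (((m + 1 : ℕ) : ℝ) - (1 - β)) < |M.det|)
    (u : EuclideanSpace ℝ (Fin (m + 1))) : (C₀ ^ m)⁻¹ * L ^ β * ‖u‖ ≤ ‖M u‖ := by
  have hL0 : 0 < L := by linarith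
  have h1 := M.abs_det_mul_norm_le (m := m) (by simp) hM u
  have h2 : L ^ (((m + 1 : ℕ) : ℝ) - (1 - β)) = L ^ m * L ^ β := by
    rw [← Real.rpow_natCast L m, ← Real.rpow_add hL0]
    congr 1
    push_cast
    ring
  rw [h2] at hdet
  have h3 : L ^ m * (L ^ β * ‖u‖) ≤ L ^ m * (C₀ ^ m * ‖M u‖) := by
    calc L ^ m * (L ^ β * ‖u‖) = L ^ m * L ^ β * ‖u‖ := by ring
      _ ≤ |M.det| * ‖u‖ := by gcongr
      _ ≤ (C₀ * L) ^ m * ‖M u‖ := h1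
      _ = L ^ m * (C₀ ^ m * ‖M u‖) := by ring
  have h4 := le_of_mul_le_mul_left h3 (by positivity)
  rw [mul_assoc, inv_mul_le_iff₀ (by positivity)]
  exact h4

/-- Each step gains `X^(-2)` with `X = L^β`. One factor `X^(-1)` pays for `336 / c²` and for `K`; as
`K` occurs only once, `n ≥ 1` is enough to absorb it. -/
theorem mul_pow_le_rpow_neg {K c L β : ℝ} (hK : 1 ≤ K) (hc : 0 < c) (hL : 1 ≤ L)
    (h : 336 * K / c ^ 2 ≤ L ^ β) {n : ℕ} (hn : 1 ≤ n) :
    K * (336 / (c * L ^ β) ^ 2) ^ n ≤ L ^ (-(β * n)) := by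
  have hL0 : 0 < L := by linarith
  have hX : 0 < L ^ β := Real.rpow_pos_of_pos hL0 β
  rw [Real.rpow_neg hL0.le, Real.rpow_mul hL0.le, Real.rpow_natCast, ← inv_pow]
  set X := L ^ β
  have h1 : 336 / (c * X) ^ 2 ≤ K⁻¹ * X⁻¹ := by
    rw [div_le_iff₀ (by positivity)] at h
    rw [div_le_iff₀ (by positivity)]
    have : K⁻¹ * X⁻¹ * (c * X) ^ 2 = (X * c ^ 2) / K := by field_simp
    rw [this, le_div_iff₀ (by positivity)]
    exact h
  calc K * (336 / (c * X) ^ 2) ^ n ≤ K * (K⁻¹ * X⁻¹) ^ n := by gcongr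
    _ = K * K⁻¹ ^ n * X⁻¹ ^ n := by rw [mul_pow]; ring
    _ ≤ K * K⁻¹ ^ 1 * X⁻¹ ^ n := by
        gcongr ?_ * _
        gcongr ?_ * ?_
        exact pow_le_pow_of_le_one (by positivity) (inv_le_one_of_one_le₀ hK) hn
    _ = X⁻¹ ^ n := by rw [pow_one, mul_inv_cancel₀ (by positivity), one_mul]

end

theorem mainTheorem5 (N : ℕ) (hN : 1 ≤ N) (C₀ : ℝ) (hC₀ : 0 < C₀) (β : ℝ) (hβ : β ∈ Set.Ioo (0 : ℝ) 1) :
    ∃ L₀ : ℝ, 1 ≤ L₀ ∧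
      ∀ f : ℝ → Torus (Fin N) → Torus (Fin N),
        (∀ L : ℝ, 1 ≤ L → TorusContDiff 1 (f L)) →
        (∀ L : ℝ, 1 ≤ L → ∀ x, ‖torusDeriv (f L) x‖ ≤ C₀ * L) →
      ∀ (Ω₀ : Type*) [MeasurableSpace Ω₀] (P₀ : Measure Ω₀) [IsProbabilityMeasure P₀]
        (R : Ω₀ → PhaseTorus N ≃ PhaseTorus N),
        (∀ z, Measurable fun ω => R ω z) →
        (∀ ω, IsC2VolDiffeo (R ω)) →
        (∀ᵐ ω ∂P₀, ConeCondition (R ω)) →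
      ∀ L : ℝ, L₀ ≤ L →
        ∀ᵐ ω ∂(Measure.infinitePi fun _ : ℕ => P₀),
          ∀ n : ℕ, 1 ≤ n → ∀ z ∈ goodOrbitSet (f L) L β R ω n,
            grassmannLeb N {E | ¬ ((E.1.map (torusDeriv (randomIterate (f L) R ω n) z).toLinearMap :
                Submodule ℝ (PhaseVec N)) : Set (PhaseVec N)) ⊆ coneX N 2} ≤
              ENNReal.ofReal (L ^ (-(β * n))) := by
  obtain ⟨m, rfl⟩ := Nat.exists_eq_add_of_le' hN
  set c : ℝ := (C₀ ^ m)⁻¹ with hc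
  have hc0 : 0 < c := by positivity
  set K : ℝ := 5 / 2 * ((m + 1 : ℕ) : ℝ) ^ 3 with hKdef
  have hK : 1 ≤ K := by
    have h1 : (1 : ℝ) ≤ ((m + 1 : ℕ) : ℝ) := by exact_mod_cast hN
    have h2 := one_le_pow₀ (n := 3) h1
    linarith
  -- The threshold for `L^β`: the first entry absorbs the constants, the second ensures `Λ = c L^β ≥
  -- 40`.
  set Y : ℝ := max (336 * K / c ^ 2) (40 / c) with hY
  have hY0 : 0 ≤ Y := le_max_of_le_right (by positivity)
  refine ⟨max 1 (Y ^ β⁻¹), le_max_left _ _, ?_⟩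
  intro f hf hfL Ω₀ _ P₀ _ R _ hR hcone L hL
  have hL1 : 1 ≤ L := (le_max_left _ _).trans hL
  have hYL : Y ≤ L ^ β := by
    calc Y = (Y ^ β⁻¹) ^ β := by rw [← Real.rpow_mul hY0, inv_mul_cancel₀ hβ.1.ne', Real.rpow_one]
      _ ≤ L ^ β := Real.rpow_le_rpow (by positivity) ((le_max_right _ _).trans hL) hβ.1.le
  have hΛ : 40 ≤ c * L ^ β := by
    have := (le_max_right _ _).trans hYL
    rwa [div_le_iff₀' hc0] at this
  -- Only countably many null sets are discarded, one per coordinate; the rest is deterministic, so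
  -- the exceptional set depends neither on `n` nor on `z`.
  have hall : ∀ᵐ ω ∂(Measure.infinitePi fun _ : ℕ => P₀), ∀ i, ConeCondition (R (ω i)) :=
    ae_all_iff.2 fun i =>
      (measurePreserving_eval_infinitePi (fun _ : ℕ => P₀) i).quasiMeasurePreserving.ae hcone
  filter_upwards [hall] with ω hω n hn z hz
  refine (grassmannLeb_not_subset_coneX_le hΛ (hf L hL1) hR hω fun i hi u =>
    mul_norm_le_of_lt_abs_det hC₀ hL1 (hfL L hL1 _) (hz i hi) u).trans
      (ENNReal.ofReal_le_ofReal ?_)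
  exact mul_pow_le_rpow_neg hK hc0 hL1 ((le_max_left _ _).trans hYL) hn
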